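/- Let $n$ be a positive integer. A cube means a cube $Q\subset\mathbb{R}^n$ of positive side length with sides parallel to the coordinate axes, and $|Q|$ is its Lebesgue measure. A weight is an (a.e.) positive locally integrable function on $\mathbb{R}^n$. For $1<p<\infty$, a weight $w$ belongs to the reverse Hölder class $RH_p$ if there is a constant $C>0$ such that for all cubes $Q$, $$\left(\frac1{|Q|}\int_Q w(x)^p\,dx\right)^{1/p}\le C\,\frac1{|Q|}\int_Q w(x)\,dx .$$ For $1<q<\infty$, a weight $v$ belongs to the Muckenhoupt class $A_q$ if there is a constant $C>0$ such that for all cubes $Q$, $$\left(\frac1{|Q|}\int_Q v(x)\,dx\right)\left(\frac1{|Q|}\int_Q v(x)^{-1/(q-1)}\,dx\right)^{q-1}\le C ,$$ and $v$ belongs to $A_1$ if there is a constant $C>0$ such that for every cube $Q$, $\frac1{|Q|}\int_Q v(y)\,dy\le C\,v(x)$ for almost every $x\in Q$. Set $A_\infty=\bigcup_{q\ge1}A_q$. **Theorem (Stromberg–Wheeden).** Let $1<p<\infty$ and let $w$ be a weight on $\mathbb{R}^n$. Then $w\in RH_p$ if and only if $w^p\in A_\infty$ (where membership of $w^p$ in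 $A_\infty$ includes that $w^p$ is a weight, i.e. is locally integrable). -/

import Mathlib

open MeasureTheory
open scoped ENNReal NNReal

namespace ReverseHolder

/-- The closed cube in `ℝⁿ` with sides parallel to the coordinate axes, lower corner `a`
and side length `l`. -/
def cube {n : ℕ} (a : Fin n → ℝ) (l : ℝ) : Set (Fin n → ℝ) :=
  Set.Icc a (fun i => a i + l)

/-- The average `|Q|⁻¹ ∫_Q g` of a (nonnegative) function `g`, as an element of `[0, ∞]`. -/
noncomputable def avg {n : ℕ} (Q : Set (Fin n → ℝ)) (g : (Fin n → ℝ) → ℝ) : ℝ≥0∞ :=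
  (volume Q)⁻¹ * ∫⁻ x in Q, ENNReal.ofReal (g x)

/-- A weight: an (almost everywhere) positive locally integrable function on `ℝⁿ`. -/
structure IsWeight {n : ℕ} (w : (Fin n → ℝ) → ℝ) : Prop where
  locallyIntegrable : LocallyIntegrable w volume
  pos : ∀ᵐ x, 0 < w x

/-- The reverse Hölder class `RH_p` (used for `1 < p < ∞`). Averages of nonnegative functions
are taken in `[0, ∞]`, so an infinite left-hand side makes the inequality fail. -/
def MemRH {n : ℕ} (p : ℝ) (w : (Fin n → ℝ) → ℝ) : Prop :=
  IsWeight w ∧ ∃ C : ℝ≥0, 0 < C ∧ ∀ (a : Fin n → ℝ) (l : ℝ), 0 < l →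
    (avg (cube a l) (fun x => w x ^ p)) ^ (1 / p) ≤
      C * avg (cube a l) w

/-- The Muckenhoupt class `A_1`. -/
def MemAOne {n : ℕ} (w : (Fin n → ℝ) → ℝ) : Prop :=
  IsWeight w ∧ ∃ C : ℝ≥0, 0 < C ∧ ∀ (a : Fin n → ℝ) (l : ℝ), 0 < l →
    ∀ᵐ x ∂(volume.restrict (cube a l)),
      avg (cube a l) w ≤ C * ENNReal.ofReal (w x)

/-- The Muckenhoupt class `A_q` (used for `1 < q < ∞`). -/
def MemA {n : ℕ} (q : ℝ) (w : (Fin n → ℝ) → ℝ) : Prop :=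
  IsWeight w ∧ ∃ C : ℝ≥0, 0 < C ∧ ∀ (a : Fin n → ℝ) (l : ℝ), 0 < l →
    avg (cube a l) w *
      (avg (cube a l) (fun x => w x ^ (-1 / (q - 1)))) ^ (q - 1) ≤ C

/-- The class `A_∞`, the union of the classes `A_q` over `1 ≤ q < ∞`. -/
def MemAInfty {n : ℕ} (w : (Fin n → ℝ) → ℝ) : Prop :=
  MemAOne w ∨ ∃ q : ℝ, 1 < q ∧ MemA q w

end ReverseHolder

/-! For RH_p ⇒ A_∞, put v = w^p and dν = v dx. If E ⊆ Q carries a small share of ν(Q), Hölder makes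
∫_E w small against |Q|^{1/r} ν(Q)^{1/p}, where r is conjugate to p. The reverse Hölder inequality
says that ∫_Q w is comparable to this quantity, so Q \ E cannot be negligible: ν(E) ≤ βν(Q) forces
|E| ≤ δ|Q| with δ < 1 (`memAInfty_of_memRH`).

Such a condition self-improves (`memAInfty_of_small_sets`). It makes ν doubling (`exists_doubling`),
so a maximal dyadic cell with ν-density below t still has density at least a fixed multiple of t.
Inside it, points lying in cells of much smaller density carry little ν-mass, hence at most a
fraction δ of the volume. Iterating, the region of Q with density below A^k T, where T is the mean
of v over Q, has volume at most δ^k |Q|. By Lebesgue differentiation these regions contain almost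
all points with v < A^k T, and summing over k bounds the mean of v^{-s} by C T^{-s} for small s.
This is A_q with q = 1 + 1/s.

Conversely, the dual factor in the A_q condition for w^p is the mean of a negative power of w, which
Hölder bounds below by a power of the mean of w (`memRH_of_memA`). The class A_1 lies in A_2. -/

namespace ReverseHolder

/-! ### Stopping times on nested countable partitions -/

/-- Comparison of two measures along the fibres of a countably valued map. -/
theorem measure_le_mul_of_fibers {X ι : Type*} [MeasurableSpace X] [Countable ι]
    (μ ν : Measure X) (h : X → ι) (hm : ∀ k, MeasurableSet (h ⁻¹' {k})) {A B : Set X}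
    {c : ℝ≥0∞} (hAB : ∀ k, ν (A ∩ h ⁻¹' {k}) ≤ c * μ (B ∩ h ⁻¹' {k})) :
    ν A ≤ c * μ B := by
  have hdisj : Pairwise (Function.onFun Disjoint fun k => h ⁻¹' {k}) := by
    intro k k' hkk
    refine Set.disjoint_left.2 fun x hx hx' => hkk ?_
    simp only [Set.mem_preimage, Set.mem_singleton_iff] at hx hx'
    rw [← hx, hx']
  have key : ∀ (m : Measure X) (S : Set X), m S = ∑' k, m (S ∩ h ⁻¹' {k}) := by
    intro m S
    have h1 := Measure.restrict_apply_univ (μ := m) S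
    have h2 : (⋃ k, h ⁻¹' {k}) = Set.univ := by
      ext x; simp
    rw [← h1, ← h2, measure_iUnion hdisj hm]
    refine tsum_congr fun k => ?_
    rw [Measure.restrict_apply (hm k), Set.inter_comm]
  rw [key ν A, key μ B, ← ENNReal.tsum_mul_left]
  exact ENNReal.tsum_le_tsum hAB

/-- The cell of level `j` containing `x`, for a sequence of partitions given by the fibres of
`idx j`. -/
def fiberCell {X ι : Type*} (idx : ℕ → X → ι) (j : ℕ) (x : X) : Set X :=
  {y | idx j y = idx j x}

/-- The points of the root cell lying in some cell where the `ν`-density is below `t`. -/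
def lowDensity {X ι : Type*} [MeasurableSpace X] (idx : ℕ → X → ι) (μ ν : Measure X) (x₀ : X)
    (t : ℝ≥0∞) : Set X :=
  {x | idx 0 x = idx 0 x₀ ∧ ∃ j, ν (fiberCell idx j x) < t * μ (fiberCell idx j x)}

section Tree

variable {X ι : Type*}

theorem idx_eq_of_le {idx : ℕ → X → ι}
    (hnest : ∀ j x y, idx (j + 1) x = idx (j + 1) y → idx j x = idx j y)
    {i j : ℕ} (hij : i ≤ j) {x y : X} (h : idx j x = idx j y) : idx i x = idx i y := by
  induction hij with
  | refl => exact h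
  | step _ ih => exact ih (hnest _ _ _ h)

theorem fiberCell_eq_of_le {idx : ℕ → X → ι}
    (hnest : ∀ j x y, idx (j + 1) x = idx (j + 1) y → idx j x = idx j y)
    {i j : ℕ} (hij : i ≤ j) {x y : X} (h : idx j y = idx j x) :
    fiberCell idx i y = fiberCell idx i x := by
  simp only [fiberCell, idx_eq_of_le hnest hij h]

variable [MeasurableSpace X]

open Classical in
/-- The first level at which the density is below `t` (and `0` if there is none). -/
noncomputable def stopTime (idx : ℕ → X → ι) (μ ν : Measure X) (t : ℝ≥0∞) (x : X) : ℕ :=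
  if h : ∃ j, ν (fiberCell idx j x) < t * μ (fiberCell idx j x) then Nat.find h else 0

theorem stopTime_spec {idx : ℕ → X → ι} {μ ν : Measure X} {t : ℝ≥0∞} {x : X}
    (h : ∃ j, ν (fiberCell idx j x) < t * μ (fiberCell idx j x)) :
    ν (fiberCell idx (stopTime idx μ ν t x) x) < t * μ (fiberCell idx (stopTime idx μ ν t x) x) ∧
      ∀ i < stopTime idx μ ν t x, t * μ (fiberCell idx i x) ≤ ν (fiberCell idx i x) := by
  classical
  simp only [stopTime, dif_pos h]
  exact ⟨Nat.find_spec h, fun i hi => not_lt.1 (Nat.find_min h hi)⟩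

theorem stopTime_eq_of_spec {idx : ℕ → X → ι} {μ ν : Measure X} {t : ℝ≥0∞} {x : X} {j : ℕ}
    (h : ν (fiberCell idx j x) < t * μ (fiberCell idx j x))
    (h' : ∀ i < j, t * μ (fiberCell idx i x) ≤ ν (fiberCell idx i x)) :
    stopTime idx μ ν t x = j := by
  have hs := stopTime_spec ⟨j, h⟩
  rcases lt_trichotomy (stopTime idx μ ν t x) j with hl | he | hl
  · exact absurd hs.1 (not_lt.2 (h' _ hl))
  · exact he
  · exact absurd h (not_lt.2 (hs.2 _ hl))

/-- Every point of the stopping cell of `x` has the same stopping time as `x`. -/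
theorem stopTime_congr {idx : ℕ → X → ι} {μ ν : Measure X} {t : ℝ≥0∞} {x y : X}
    (hnest : ∀ j x y, idx (j + 1) x = idx (j + 1) y → idx j x = idx j y)
    (h : ∃ j, ν (fiberCell idx j x) < t * μ (fiberCell idx j x))
    (hy : idx (stopTime idx μ ν t x) y = idx (stopTime idx μ ν t x) x) :
    stopTime idx μ ν t y = stopTime idx μ ν t x ∧
      ∃ j, ν (fiberCell idx j y) < t * μ (fiberCell idx j y) := by
  have hs := stopTime_spec h
  have h1 : ν (fiberCell idx (stopTime idx μ ν t x) y) <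
      t * μ (fiberCell idx (stopTime idx μ ν t x) y) := by
    rw [fiberCell_eq_of_le hnest le_rfl hy]; exact hs.1
  refine ⟨stopTime_eq_of_spec h1 fun i hi => ?_, _, h1⟩
  rw [fiberCell_eq_of_le hnest hi.le hy]; exact hs.2 i hi

/-- The stopping time together with the index of the stopping cell. -/
noncomputable def stopIndex (idx : ℕ → X → ι) (μ ν : Measure X) (t : ℝ≥0∞) (x : X) : ℕ × ι :=
  (stopTime idx μ ν t x, idx (stopTime idx μ ν t x) x)

/-- Level sets of functions which are constant on cells are measurable. -/
theorem measurableSet_of_cells [Countable ι] {idx : ℕ → X → ι}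
    (hmeas : ∀ j k, MeasurableSet (idx j ⁻¹' {k})) (j : ℕ) {S : Set X}
    (hS : ∀ x ∈ S, ∀ y, idx j y = idx j x → y ∈ S) : MeasurableSet S := by
  have : S = ⋃ k ∈ idx j '' S, idx j ⁻¹' {k} := by
    ext y
    simp only [Set.mem_image, Set.iUnion_exists, Set.mem_iUnion, Set.mem_preimage,
      Set.mem_singleton_iff, exists_prop]
    constructor
    · intro hy; exact ⟨_, y, ⟨hy, rfl⟩, rfl⟩
    · rintro ⟨k, x, ⟨hx, rfl⟩, hy⟩; exact hS x hx y hy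
  rw [this]
  exact MeasurableSet.biUnion (Set.to_countable _) fun k _ => hmeas j k

theorem measurableSet_low [Countable ι] {idx : ℕ → X → ι} (μ ν : Measure X) (t : ℝ≥0∞)
    (hmeas : ∀ j k, MeasurableSet (idx j ⁻¹' {k})) :
    MeasurableSet {x | ∃ j, ν (fiberCell idx j x) < t * μ (fiberCell idx j x)} := by
  rw [Set.ofPred_exists]
  refine MeasurableSet.iUnion fun j => measurableSet_of_cells hmeas j fun x hx y hy => ?_
  have : fiberCell idx j y = fiberCell idx j x := by simp only [fiberCell, hy]
  simpa only [Set.mem_ofPred_eq, this] using hx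

theorem measurableSet_lowDensity [Countable ι] {idx : ℕ → X → ι} (μ ν : Measure X) (x₀ : X)
    (t : ℝ≥0∞) (hmeas : ∀ j k, MeasurableSet (idx j ⁻¹' {k})) :
    MeasurableSet (lowDensity idx μ ν x₀ t) :=
  (hmeas 0 (idx 0 x₀)).inter (measurableSet_low μ ν t hmeas)

theorem measurableSet_stopIndex_fiber [Countable ι] {idx : ℕ → X → ι} (μ ν : Measure X)
    (t : ℝ≥0∞) (hnest : ∀ j x y, idx (j + 1) x = idx (j + 1) y → idx j x = idx j y)
    (hmeas : ∀ j k, MeasurableSet (idx j ⁻¹' {k})) (k : ℕ × ι) :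
    MeasurableSet (stopIndex idx μ ν t ⁻¹' {k}) := by
  obtain ⟨j, κ⟩ := k
  set L := {x | ∃ j, ν (fiberCell idx j x) < t * μ (fiberCell idx j x)} with hL
  have hLm : MeasurableSet L := measurableSet_low μ ν t hmeas
  have h1 : MeasurableSet (L ∩ stopIndex idx μ ν t ⁻¹' {(j, κ)}) := by
    refine measurableSet_of_cells hmeas j ?_
    rintro x ⟨hx, hxk⟩ y hy
    simp only [Set.mem_preimage, Set.mem_singleton_iff, stopIndex, Prod.mk.injEq] at hxk
    obtain ⟨hj, hκ⟩ := hxk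
    have := stopTime_congr hnest hx (y := y) (by rw [hj]; exact hy)
    refine ⟨this.2, ?_⟩
    simp only [Set.mem_preimage, Set.mem_singleton_iff, stopIndex, Prod.mk.injEq]
    rw [this.1, hj]
    refine ⟨rfl, ?_⟩
    rw [hy, ← hκ, hj]
  have h2 : MeasurableSet (Lᶜ ∩ stopIndex idx μ ν t ⁻¹' {(j, κ)}) := by
    -- Off `L` the stopping time takes its default value 0, so the fibre there is either empty or
    -- cut out by a level-0 cell.
    have h0 : ∀ x ∈ Lᶜ, stopTime idx μ ν t x = 0 := by
      intro x hx
      exact dif_neg hx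
    have : Lᶜ ∩ stopIndex idx μ ν t ⁻¹' {(j, κ)} = Lᶜ ∩ {x | 0 = j ∧ x ∈ idx 0 ⁻¹' {κ}} := by
      ext x
      simp only [Set.mem_inter_iff]
      refine and_congr_right fun hx => ?_
      simp [stopIndex, h0 x hx]
    rw [this]
    refine hLm.compl.inter ?_
    by_cases hj : 0 = j
    · simp only [hj, true_and]
      exact hmeas j κ
    · simp [hj]
  have := h1.union h2
  rwa [← Set.union_inter_distrib_right, Set.union_compl_self, Set.univ_inter] at this

/-- One step of the stopping argument: passing from the threshold `t` to a much smaller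
threshold `s` shrinks the low density set by a fixed factor. -/
theorem measure_lowDensity_le [Countable ι] {idx : ℕ → X → ι} (μ ν : Measure X)
    (x₀ : X) {s t β δ K : ℝ≥0∞}
    (hnest : ∀ j x y, idx (j + 1) x = idx (j + 1) y → idx j x = idx j y)
    (hmeas : ∀ j k, MeasurableSet (idx j ⁻¹' {k}))
    (hK : ∀ j x, ν (fiberCell idx j x) ≤ K * ν (fiberCell idx (j + 1) x))
    (hδ : ∀ j x E, MeasurableSet E → E ⊆ fiberCell idx j x →
      ν E ≤ β * ν (fiberCell idx j x) → μ E ≤ δ * μ (fiberCell idx j x))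
    (h0 : t * μ (fiberCell idx 0 x₀) ≤ ν (fiberCell idx 0 x₀))
    (hst : s ≤ t) (hs : s ≤ β * K⁻¹ * t) :
    μ (lowDensity idx μ ν x₀ s) ≤ δ * μ (lowDensity idx μ ν x₀ t) := by
  have hmono : ∀ x, (∃ j, ν (fiberCell idx j x) < s * μ (fiberCell idx j x)) →
      ∃ j, ν (fiberCell idx j x) < t * μ (fiberCell idx j x) := by
    rintro x ⟨j, hj⟩
    exact ⟨j, hj.trans_le (by gcongr)⟩
  refine measure_le_mul_of_fibers μ μ (stopIndex idx μ ν t)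
    (measurableSet_stopIndex_fiber μ ν t hnest hmeas) fun k => ?_
  rcases Set.eq_empty_or_nonempty (lowDensity idx μ ν x₀ t ∩ stopIndex idx μ ν t ⁻¹' {k}) with
    he | ⟨x, ⟨hx0, hx⟩, hxk⟩
  · have : lowDensity idx μ ν x₀ s ∩ stopIndex idx μ ν t ⁻¹' {k} = ∅ := by
      refine Set.subset_empty_iff.1 (he ▸ Set.inter_subset_inter_left _ ?_)
      exact fun y hy => ⟨hy.1, hmono y hy.2⟩
    simp [this]
  set m := stopTime idx μ ν t x with hm
  simp only [Set.mem_preimage, Set.mem_singleton_iff] at hxk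
  subst hxk
  -- Each nonempty piece of the `t`-low set is exactly one stopping cell, so `hδ` can be applied
  -- cell by cell.
  have hcell : lowDensity idx μ ν x₀ t ∩ stopIndex idx μ ν t ⁻¹' {stopIndex idx μ ν t x} =
      fiberCell idx m x := by
    ext y
    simp only [Set.mem_inter_iff, Set.mem_preimage, Set.mem_singleton_iff, stopIndex,
      Prod.mk.injEq]
    constructor
    · rintro ⟨_, h1, h2⟩
      rw [h1] at h2
      exact h2
    · intro hy
      have hy' : idx m y = idx m x := hy
      have := stopTime_congr hnest hx hy'
      refine ⟨⟨?_, this.2⟩, this.1, ?_⟩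
      · rw [idx_eq_of_le hnest (Nat.zero_le m) hy', hx0]
      · rw [this.1]; exact hy'
  have hsub : lowDensity idx μ ν x₀ s ∩ stopIndex idx μ ν t ⁻¹' {stopIndex idx μ ν t x} ⊆
      lowDensity idx μ ν x₀ s ∩ fiberCell idx m x := by
    intro y hy
    refine ⟨hy.1, ?_⟩
    rw [← hcell]
    exact ⟨⟨hy.1.1, hmono y hy.1.2⟩, hy.2⟩
  rw [hcell]
  refine (measure_mono hsub).trans (hδ m x _ ?_ Set.inter_subset_right ?_)
  · exact (measurableSet_lowDensity μ ν x₀ s hmeas).inter (hmeas m _)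
  have hspec := stopTime_spec hx
  -- The root has density at least `t`, so the stopping cell has a parent. The parent's density is
  -- at least `t`, and `hK` transfers this to the cell with a loss of `K`.
  have hmpos : m ≠ 0 := by
    intro h
    rw [← hm, h] at hspec
    have he : fiberCell idx 0 x = fiberCell idx 0 x₀ := by simp only [fiberCell, hx0]
    rw [he] at hspec
    exact absurd hspec.1 (not_lt.2 h0)
  obtain ⟨m', hm'⟩ := Nat.exists_eq_succ_of_ne_zero hmpos
  have hupper : s * μ (fiberCell idx m x) ≤ β * ν (fiberCell idx m x) := by
    have h1 : fiberCell idx m x ⊆ fiberCell idx m' x := by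
      intro y hy
      exact idx_eq_of_le hnest (by omega) hy
    calc s * μ (fiberCell idx m x) ≤ β * K⁻¹ * t * μ (fiberCell idx m' x) := by gcongr
      _ = β * K⁻¹ * (t * μ (fiberCell idx m' x)) := by ring
      _ ≤ β * K⁻¹ * ν (fiberCell idx m' x) := by
          gcongr
          exact hspec.2 m' (by omega)
      _ ≤ β * K⁻¹ * (K * ν (fiberCell idx m x)) := by
          gcongr
          rw [hm']; exact hK m' x
      _ = β * (K⁻¹ * K) * ν (fiberCell idx m x) := by ring
      _ ≤ β * 1 * ν (fiberCell idx m x) := by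
          gcongr
          exact ENNReal.inv_mul_le_one K
      _ = _ := by rw [mul_one]
  refine le_trans ?_ hupper
  -- The `s`-low part of the cell is covered by `s`-stopping cells, each of density below `s`. As `s
  -- ≤ t`, they stop no earlier than level `m` and so lie inside the cell.
  refine measure_le_mul_of_fibers μ ν (stopIndex idx μ ν s)
    (measurableSet_stopIndex_fiber μ ν s hnest hmeas) fun k => ?_
  rcases Set.eq_empty_or_nonempty (lowDensity idx μ ν x₀ s ∩ fiberCell idx m x ∩
    stopIndex idx μ ν s ⁻¹' {k}) with he | ⟨z, ⟨⟨hz0, hz⟩, hzm⟩, hzk⟩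
  · simp [he]
  simp only [Set.mem_preimage, Set.mem_singleton_iff] at hzk
  subst hzk
  have hzs := stopTime_spec hz
  have hle : m ≤ stopTime idx μ ν s z := by
    by_contra! hlt
    have hlt2 : ν (fiberCell idx (stopTime idx μ ν s z) z) <
      t * μ (fiberCell idx (stopTime idx μ ν s z) z) := hzs.1.trans_le (by gcongr)
    rw [fiberCell_eq_of_le hnest hlt.le hzm] at hlt2
    exact absurd hlt2 (not_lt.2 (hspec.2 _ hlt))
  have hA : lowDensity idx μ ν x₀ s ∩ fiberCell idx m x ∩
      stopIndex idx μ ν s ⁻¹' {stopIndex idx μ ν s z} ⊆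
      fiberCell idx (stopTime idx μ ν s z) z := by
    rintro y ⟨_, hy⟩
    simp only [Set.mem_preimage, Set.mem_singleton_iff, stopIndex, Prod.mk.injEq] at hy
    have h2 := hy.2
    rw [hy.1] at h2
    exact h2
  have hB : fiberCell idx (stopTime idx μ ν s z) z ⊆
      fiberCell idx m x ∩ stopIndex idx μ ν s ⁻¹' {stopIndex idx μ ν s z} := by
    intro y hy
    have hc := stopTime_congr hnest hz hy
    refine ⟨(idx_eq_of_le hnest hle hy).trans hzm, ?_⟩
    simp only [Set.mem_preimage, Set.mem_singleton_iff, stopIndex, Prod.mk.injEq]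
    exact ⟨hc.1, by rw [hc.1]; exact hy⟩
  calc _ ≤ ν (fiberCell idx (stopTime idx μ ν s z) z) := measure_mono hA
    _ ≤ s * μ (fiberCell idx (stopTime idx μ ν s z) z) := hzs.1.le
    _ ≤ _ := by gcongr

/-- Geometric decay of the low density sets. -/
theorem measure_lowDensity_pow_le [Countable ι] {idx : ℕ → X → ι} (μ ν : Measure X)
    (x₀ : X) {t β δ K : ℝ≥0∞}
    (hnest : ∀ j x y, idx (j + 1) x = idx (j + 1) y → idx j x = idx j y)
    (hmeas : ∀ j k, MeasurableSet (idx j ⁻¹' {k}))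
    (hK : ∀ j x, ν (fiberCell idx j x) ≤ K * ν (fiberCell idx (j + 1) x))
    (hδ : ∀ j x E, MeasurableSet E → E ⊆ fiberCell idx j x →
      ν E ≤ β * ν (fiberCell idx j x) → μ E ≤ δ * μ (fiberCell idx j x))
    (h0 : t * μ (fiberCell idx 0 x₀) ≤ ν (fiberCell idx 0 x₀))
    (hβK : β * K⁻¹ ≤ 1) (k : ℕ) :
    μ (lowDensity idx μ ν x₀ ((β * K⁻¹) ^ k * t)) ≤ δ ^ k * μ (fiberCell idx 0 x₀) := by
  induction k with
  | zero =>
    simp only [pow_zero, one_mul]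
    exact measure_mono fun x hx => hx.1
  | succ k ih =>
    have h1 := measure_lowDensity_le μ ν x₀ (s := (β * K⁻¹) ^ (k + 1) * t)
      (t := (β * K⁻¹) ^ k * t) hnest hmeas hK hδ
      (le_trans (by
        gcongr
        calc (β * K⁻¹) ^ k * t ≤ 1 * t := by gcongr; exact pow_le_one' hβK k
          _ = t := one_mul t) h0)
      (by
        gcongr ?_ * t
        exact pow_le_pow_right_of_le_one' hβK (Nat.le_succ k))
      (by rw [pow_succ']; ring_nf; exact le_rfl)
    calc _ ≤ _ := h1
      _ ≤ δ * (δ ^ k * μ (fiberCell idx 0 x₀)) := by gcongr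
      _ = _ := by rw [pow_succ']; ring

end Tree

/-! ### Cubes and the doubling property -/

section Cubes
variable {n : ℕ}

theorem volume_cube (a : Fin n → ℝ) (l : ℝ) : volume (cube a l) = ENNReal.ofReal l ^ n := by
  simp [cube, Real.volume_Icc_pi]

theorem volume_cube_ne_top (a : Fin n → ℝ) (l : ℝ) : volume (cube a l) ≠ ∞ := by
  rw [volume_cube]; exact ENNReal.pow_ne_top ENNReal.ofReal_ne_top

theorem volume_cube_ne_zero (a : Fin n → ℝ) {l : ℝ} (hl : 0 < l) : volume (cube a l) ≠ 0 := by
  rw [volume_cube]; exact pow_ne_zero _ (ENNReal.ofReal_pos.2 hl).ne'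

theorem measurableSet_cube (a : Fin n → ℝ) (l : ℝ) : MeasurableSet (cube a l) :=
  measurableSet_Icc

theorem isCompact_cube (a : Fin n → ℝ) (l : ℝ) : IsCompact (cube a l) := isCompact_Icc

theorem cube_eq_closedBall (a : Fin n → ℝ) {l : ℝ} (hl : 0 ≤ l) :
    cube a l = Metric.closedBall (fun i => a i + l / 2) (l / 2) := by
  rw [closedBall_pi _ (by positivity), cube, ← Set.pi_univ_Icc]
  congr 1
  ext i : 1
  rw [Real.closedBall_eq_Icc]
  congr 1 <;> ring

/-- Halving the side of a cube splits into `m` equal shrinkings, each of which keeps more than a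
fraction `δ` of the volume. -/
theorem exists_pow_rpow_half_gt (n : ℕ) {δ : ℝ≥0∞} (hδ : δ < 1) :
    ∃ m : ℕ, 0 < m ∧ δ < ENNReal.ofReal ((1 / 2 : ℝ) ^ (1 / (m : ℝ))) ^ n := by
  have h1 : Filter.Tendsto (fun m : ℕ => ENNReal.ofReal ((1 / 2 : ℝ) ^ (1 / (m : ℝ))) ^ n)
      Filter.atTop (nhds (ENNReal.ofReal ((1 / 2 : ℝ) ^ (0 : ℝ)) ^ n)) := by
    refine ENNReal.Tendsto.pow (ENNReal.tendsto_ofReal ?_)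
    exact (Real.continuousAt_const_rpow (by norm_num)).tendsto.comp
      tendsto_one_div_atTop_nhds_zero_nat
  rw [Real.rpow_zero, ENNReal.ofReal_one, one_pow] at h1
  obtain ⟨m, hm, hm0⟩ := ((h1.eventually (lt_mem_nhds hδ)).and
    (Filter.eventually_gt_atTop 0)).exists
  exact ⟨m, hm0, hm⟩

/-- A measure for which sets of small relative measure are not almost full in a cube is
doubling. -/
theorem exists_doubling (ν : Measure (Fin n → ℝ)) {β δ : ℝ≥0∞} (hβ : β ≠ 0) (hδ1 : δ < 1)
    (hδ : ∀ (a : Fin n → ℝ) (l : ℝ), 0 < l → ∀ E, MeasurableSet E → E ⊆ cube a l →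
      ν E ≤ β * ν (cube a l) → volume E ≤ δ * volume (cube a l)) :
    ∃ K : ℝ≥0∞, ∀ (a a' : Fin n → ℝ) (l : ℝ), 0 < l → (∀ i, a i ≤ a' i) →
      (∀ i, a' i ≤ a i + l / 2) → ν (cube a l) ≤ K * ν (cube a' (l / 2)) ∧ K ≠ ∞ := by
  obtain ⟨m, hm0, hm⟩ := exists_pow_rpow_half_gt n hδ1
  set r : ℝ := (1 / 2 : ℝ) ^ (1 / (m : ℝ)) with hr
  have hr0 : 0 < r := by positivity
  have hr1 : r ≤ 1 := Real.rpow_le_one (by norm_num) (by norm_num) (by positivity)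
  have hrm : r ^ m = 1 / 2 := by
    rw [hr, one_div (m : ℝ)]
    exact Real.rpow_inv_natCast_pow (by norm_num) hm0.ne'
  refine ⟨β⁻¹ ^ m, fun a a' l hl h1 h2 => ⟨?_, ENNReal.pow_ne_top (ENNReal.inv_ne_top.2 hβ)⟩⟩
  -- The homothety taking the large cube to the half-size one has fixed point `2a' - a`. The
  -- intermediate cubes shrink towards it by ratio `r`, and `r ^ m = 1/2` makes the last corner
  -- `a'`.
  set c : ℕ → Fin n → ℝ := fun j i => a i + (1 - r ^ j) * (2 * (a' i - a i)) with hc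
  have key : ∀ j, ν (cube a l) ≤ β⁻¹ ^ j * ν (cube (c j) (r ^ j * l)) := by
    intro j
    induction j with
    | zero => simp [hc]
    | succ j ih =>
      refine ih.trans ?_
      have hd : 0 ≤ r ^ j - r ^ (j + 1) := by
        rw [pow_succ]
        nlinarith [pow_pos hr0 j]
      have hsub : cube (c (j + 1)) (r ^ (j + 1) * l) ⊆ cube (c j) (r ^ j * l) := by
        refine Set.Icc_subset_Icc (fun i => ?_) (fun i => ?_)
        · simp only [hc]
          nlinarith [h1 i, h2 i, mul_nonneg hd (sub_nonneg.2 (h1 i))]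
        · simp only [hc]
          have : 0 ≤ l - 2 * (a' i - a i) := by linarith [h2 i]
          nlinarith [mul_nonneg hd this]
      -- Otherwise `hδ` would bound the volume ratio `r ^ n` by `δ`. Each shrinking thus keeps more
      -- than a share `β` of the mass, whence the constant `β⁻¹ ^ m`.
      have hlt : β * ν (cube (c j) (r ^ j * l)) < ν (cube (c (j + 1)) (r ^ (j + 1) * l)) := by
        by_contra! hcon
        have h3 := hδ (c j) (r ^ j * l) (by positivity) _ (measurableSet_cube _ _) hsub hcon
        have hv : volume (cube (c (j + 1)) (r ^ (j + 1) * l)) =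
            ENNReal.ofReal r ^ n * volume (cube (c j) (r ^ j * l)) := by
          rw [volume_cube, volume_cube, ← mul_pow, ← ENNReal.ofReal_mul hr0.le]
          congr 2
          ring
        rw [hv] at h3
        refine absurd h3 (not_le.2 ?_)
        exact (ENNReal.mul_lt_mul_iff_left (volume_cube_ne_zero _ (by positivity))
          (volume_cube_ne_top _ _)).2 hm
      rw [pow_succ, mul_assoc]
      gcongr
      rcases eq_or_ne β ∞ with rfl | hβt
      · by_cases h0 : ν (cube (c j) (r ^ j * l)) = 0
        · simp [h0]
        · rw [ENNReal.top_mul h0] at hlt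
          exact absurd hlt (not_lt.2 le_top)
      · rw [← ENNReal.div_eq_inv_mul, ENNReal.le_div_iff_mul_le (Or.inl hβ) (Or.inl hβt),
          mul_comm]
        exact hlt.le
  have := key m
  rw [hrm] at this
  convert this using 3
  · congr 1
    · ext i
      simp only [hc, hrm]
      ring
    · ring

/-! ### Dyadic subdivision of a cube -/

/-- The index of the dyadic cell of level `j`, relative to the cube with corner `a` and side `l`,
containing a point. -/
noncomputable def dyadicIndex (a : Fin n → ℝ) (l : ℝ) (j : ℕ) (x : Fin n → ℝ) : Fin n → ℤ :=
  fun i => ⌊2 ^ j * ((x i - a i) / l)⌋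

/-- The lower corner of the dyadic cell of level `j` containing `x`. -/
noncomputable def dyadicCorner (a : Fin n → ℝ) (l : ℝ) (j : ℕ) (x : Fin n → ℝ) : Fin n → ℝ :=
  fun i => a i + dyadicIndex a l j x i * (l / 2 ^ j)

theorem dyadicIndex_eq_div_two (a : Fin n → ℝ) (l : ℝ) (j : ℕ) (x : Fin n → ℝ) (i : Fin n) :
    dyadicIndex a l j x i = dyadicIndex a l (j + 1) x i / 2 := by
  have h : (2 : ℝ) ^ j * ((x i - a i) / l) = (2 ^ (j + 1) * ((x i - a i) / l)) / (2 : ℕ) := by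
    push_cast; ring
  simp only [dyadicIndex]
  rw [h, Int.floor_div_natCast]
  rfl

theorem dyadicIndex_nested (a : Fin n → ℝ) (l : ℝ) (j : ℕ) (x y : Fin n → ℝ)
    (h : dyadicIndex a l (j + 1) x = dyadicIndex a l (j + 1) y) :
    dyadicIndex a l j x = dyadicIndex a l j y := by
  ext i
  rw [dyadicIndex_eq_div_two a l j x, dyadicIndex_eq_div_two a l j y, h]

theorem measurable_dyadicIndex (a : Fin n → ℝ) (l : ℝ) (j : ℕ) :
    Measurable (dyadicIndex a l j) := by
  refine measurable_pi_lambda _ fun i => Int.measurable_floor.comp ?_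
  fun_prop

theorem fiberCell_dyadicIndex (a : Fin n → ℝ) {l : ℝ} (hl : 0 < l) (j : ℕ) (x : Fin n → ℝ) :
    fiberCell (dyadicIndex a l) j x = Set.pi Set.univ
      (fun i => Set.Ico (dyadicCorner a l j x i) (dyadicCorner a l j x i + l / 2 ^ j)) := by
  ext y
  simp only [fiberCell, Set.mem_ofPred_eq, Set.mem_pi, Set.mem_univ, true_imp_iff, funext_iff]
  refine forall_congr' fun i => ?_
  simp only [dyadicCorner]
  generalize dyadicIndex a l j x i = k
  simp only [dyadicIndex, Int.floor_eq_iff, Set.mem_Ico]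
  have h2 : (0 : ℝ) < 2 ^ j := by positivity
  have e : (2 : ℝ) ^ j * ((y i - a i) / l) = (y i - a i) / (l / 2 ^ j) := by
    field_simp
  have hs : 0 < l / 2 ^ j := by positivity
  rw [e, le_div_iff₀ hs, div_lt_iff₀ hs]
  constructor <;> rintro ⟨h, h'⟩ <;> constructor <;> linarith

/-- Half-open cells give genuine partitions, while the hypotheses concern closed cubes; the faces
are null. -/
theorem fiberCell_ae_eq_cube (a : Fin n → ℝ) {l : ℝ} (hl : 0 < l) (j : ℕ) (x : Fin n → ℝ) :
    fiberCell (dyadicIndex a l) j x =ᵐ[volume] cube (dyadicCorner a l j x) (l / 2 ^ j) := by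
  rw [fiberCell_dyadicIndex a hl, cube]
  exact Measure.univ_pi_Ico_ae_eq_Icc

theorem fiberCell_subset_cube (a : Fin n → ℝ) {l : ℝ} (hl : 0 < l) (j : ℕ) (x : Fin n → ℝ) :
    fiberCell (dyadicIndex a l) j x ⊆ cube (dyadicCorner a l j x) (l / 2 ^ j) := by
  rw [fiberCell_dyadicIndex a hl, cube, ← Set.pi_univ_Icc]
  exact Set.pi_mono fun i _ => Set.Ico_subset_Icc_self

/-- Each coordinate of the corner moves by 0 or half a side, which places the child as
`exists_doubling` requires. -/
theorem dyadicCorner_succ (a : Fin n → ℝ) {l : ℝ} (hl : 0 < l) (j : ℕ) (x : Fin n → ℝ)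
    (i : Fin n) : dyadicCorner a l j x i ≤ dyadicCorner a l (j + 1) x i ∧
      dyadicCorner a l (j + 1) x i ≤ dyadicCorner a l j x i + l / 2 ^ j / 2 := by
  simp only [dyadicCorner]
  rw [dyadicIndex_eq_div_two a l j]
  generalize dyadicIndex a l (j + 1) x i = k
  have h1 : 2 * (k / 2) ≤ k := by omega
  have h2 : k ≤ 2 * (k / 2) + 1 := by omega
  have h1' : 2 * ((k / 2 : ℤ) : ℝ) ≤ k := by exact_mod_cast h1
  have h2' : (k : ℝ) ≤ 2 * ((k / 2 : ℤ) : ℝ) + 1 := by exact_mod_cast h2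
  have hs : 0 < l / 2 ^ (j + 1) := by positivity
  have e : l / 2 ^ j = 2 * (l / 2 ^ (j + 1)) := by rw [pow_succ]; field_simp
  rw [e]
  generalize l / 2 ^ (j + 1) = s at *
  constructor <;> nlinarith

/-- Geometric decay of the low density sets, for dyadic cells. -/
theorem exists_measure_lowDensity_decay (ν : Measure (Fin n → ℝ)) (hν : ν ≪ volume)
    {β δ : ℝ≥0∞} (hβ : β ≠ 0) (hβ1 : β < 1) (hδ1 : δ < 1)
    (hδ : ∀ (a : Fin n → ℝ) (l : ℝ), 0 < l → ∀ E, MeasurableSet E → E ⊆ cube a l →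
      ν E ≤ β * ν (cube a l) → volume E ≤ δ * volume (cube a l)) :
    ∃ A : ℝ≥0∞, A ≠ 0 ∧ A < 1 ∧ ∀ (a : Fin n → ℝ) (l : ℝ), 0 < l → ∀ k : ℕ,
      volume (lowDensity (dyadicIndex a l) volume ν a
        (A ^ k * (ν (cube a l) / volume (cube a l)))) ≤ δ ^ k * volume (cube a l) := by
  obtain ⟨K, hK⟩ := exists_doubling ν hβ hδ1 hδ
  have hKt : K ≠ ∞ :=
    (hK 0 0 1 one_pos (fun _ => le_rfl) (fun _ => by simp)).2
  -- Enlarging the doubling constant to at least 1 guarantees that the ratio of successive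
  -- thresholds is below 1.
  have hA1 : β * (max K 1)⁻¹ < 1 := by
    refine lt_of_le_of_lt ?_ hβ1
    calc β * (max K 1)⁻¹ ≤ β * 1 := by
          gcongr
          exact ENNReal.inv_le_one.2 (le_max_right _ _)
      _ = β := mul_one _
  refine ⟨β * (max K 1)⁻¹, mul_ne_zero hβ (ENNReal.inv_ne_zero.2 (max_ne_top hKt (by simp))), hA1,
    fun a l hl k => ?_⟩
  have hcv : ∀ j x, volume (fiberCell (dyadicIndex a l) j x) =
      volume (cube (dyadicCorner a l j x) (l / 2 ^ j)) := fun j x =>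
    measure_congr (fiberCell_ae_eq_cube a hl j x)
  have hcν : ∀ j x, ν (fiberCell (dyadicIndex a l) j x) =
      ν (cube (dyadicCorner a l j x) (l / 2 ^ j)) := fun j x =>
    measure_congr (hν.ae_le (fiberCell_ae_eq_cube a hl j x))
  have hroot : dyadicCorner a l 0 a = a := by
    ext i; simp [dyadicCorner, dyadicIndex]
  have h0v := hcv 0 a
  have h0ν := hcν 0 a
  rw [hroot, pow_zero, div_one] at h0v h0ν
  have := measure_lowDensity_pow_le (volume : Measure (Fin n → ℝ)) ν a (idx := dyadicIndex a l)
    (t := ν (cube a l) / volume (cube a l)) (β := β) (δ := δ) (K := max K 1)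
    (dyadicIndex_nested a l)
    (fun j k => measurable_dyadicIndex a l j (measurableSet_singleton k)) ?_ ?_ ?_ hA1.le k
  · rwa [h0v] at this
  · intro j x
    rw [hcν, hcν]
    have h2 := (hK (dyadicCorner a l j x) (dyadicCorner a l (j + 1) x) (l / 2 ^ j)
      (by positivity) (fun i => (dyadicCorner_succ a hl j x i).1)
      (fun i => (dyadicCorner_succ a hl j x i).2)).1
    rw [div_div, ← pow_succ] at h2
    refine h2.trans ?_
    gcongr
    exact le_max_left _ _
  · intro j x E hE hsub hle
    rw [hcν] at hle
    rw [hcv]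
    exact hδ _ _ (by positivity) E hE (hsub.trans (fiberCell_subset_cube a hl j x)) hle
  · rw [h0v, h0ν]
    exact (ENNReal.div_mul_cancel (volume_cube_ne_zero a hl) (volume_cube_ne_top a l)).le

end Cubes

/-! ### From the small-set condition to A_∞ -/

section Weights

variable {n : ℕ}

/-- By Lebesgue differentiation, almost every point at which the density is below `t` lies in a
dyadic cell of average below `t`. -/
theorem ae_exists_fiberCell_lt {v : (Fin n → ℝ) → ℝ} (hv : IsWeight v) (a : Fin n → ℝ) {l : ℝ}
    (hl : 0 < l) : ∀ᵐ x, ∀ t : ℝ≥0∞, ENNReal.ofReal (v x) < t → ∃ j,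
      volume.withDensity (fun x => ENNReal.ofReal (v x)) (fiberCell (dyadicIndex a l) j x) <
        t * volume (fiberCell (dyadicIndex a l) j x) := by
  set ν := (volume : Measure (Fin n → ℝ)).withDensity (fun x => ENNReal.ofReal (v x)) with hν
  filter_upwards [IsUnifLocDoublingMeasure.ae_tendsto_average
    (volume : Measure (Fin n → ℝ)) hv.locallyIntegrable 1] with x hx t ht
  set r : ℕ → ℝ := fun j => l / 2 ^ j / 2 with hr
  have hr0 : ∀ j, 0 < r j := fun j => by positivity
  have hlim : Filter.Tendsto r Filter.atTop (nhdsWithin 0 (Set.Ioi 0)) := by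
    refine tendsto_nhdsWithin_iff.2 ⟨?_, Filter.Eventually.of_forall hr0⟩
    have h1 : Filter.Tendsto (fun j : ℕ => l / 2 * (1 / 2 : ℝ) ^ j) Filter.atTop (nhds (l / 2 * 0)) :=
      (tendsto_pow_atTop_nhds_zero_of_lt_one (by norm_num) (by norm_num)).const_mul _
    rw [mul_zero] at h1
    refine h1.congr fun j => ?_
    simp only [hr, one_div, inv_pow]
    field_simp
  have hcb : ∀ j, cube (dyadicCorner a l j x) (l / 2 ^ j) =
      Metric.closedBall (fun i => dyadicCorner a l j x i + l / 2 ^ j / 2) (r j) := fun j =>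
    cube_eq_closedBall _ (by positivity)
  -- Closed cubes are sup-norm balls. The differentiation theorem does not need them centred at `x`;
  -- it is enough that they contain `x`, hence the factor 1.
  have h2 := hx (fun j => fun i => dyadicCorner a l j x i + l / 2 ^ j / 2) r hlim
    (Filter.Eventually.of_forall fun j => by
      rw [one_mul, ← hcb]
      exact fiberCell_subset_cube a hl j x rfl)
  obtain ⟨u, hu0, hut⟩ := ENNReal.lt_iff_exists_nnreal_btwn.1 ht
  have hvu : v x < u := by
    rw [← ENNReal.ofReal_coe_nnreal] at hu0
    exact (ENNReal.ofReal_lt_ofReal_iff'.1 hu0).1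
  obtain ⟨j, hj⟩ := (h2.eventually (gt_mem_nhds hvu)).exists
  refine ⟨j, ?_⟩
  rw [measure_congr (fiberCell_ae_eq_cube a hl j x), measure_congr
    ((withDensity_absolutelyContinuous _ _).ae_le (fiberCell_ae_eq_cube a hl j x))]
  rw [← hcb] at hj
  set Q := cube (dyadicCorner a l j x) (l / 2 ^ j) with hQ
  have hQ0 : volume Q ≠ 0 := volume_cube_ne_zero _ (by positivity)
  have hQt : volume Q ≠ ∞ := volume_cube_ne_top _ _
  have hQr : 0 < volume.real Q := ENNReal.toReal_pos hQ0 hQt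
  have hint : IntegrableOn v Q := hv.locallyIntegrable.integrableOn_isCompact (isCompact_cube _ _)
  rw [withDensity_apply _ (measurableSet_cube _ _), ← ofReal_integral_eq_lintegral_ofReal hint
    (ae_restrict_of_ae (hv.pos.mono fun y hy => hy.le))]
  rw [setAverage_eq, smul_eq_mul, inv_mul_lt_iff₀ hQr] at hj
  calc ENNReal.ofReal (∫ y in Q, v y) ≤ ENNReal.ofReal (volume.real Q * u) :=
        ENNReal.ofReal_le_ofReal hj.le
    _ = u * volume Q := by
        rw [mul_comm, ENNReal.ofReal_mul u.coe_nonneg, ENNReal.ofReal_coe_nnreal,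
          Measure.real, ENNReal.ofReal_toReal hQt]
    _ < t * volume Q := (ENNReal.mul_lt_mul_iff_left hQ0 hQt).2 hut

theorem withDensity_cube (v : (Fin n → ℝ) → ℝ) (a : Fin n → ℝ) (l : ℝ) :
    volume.withDensity (fun x => ENNReal.ofReal (v x)) (cube a l) / volume (cube a l) =
      avg (cube a l) v := by
  rw [avg, withDensity_apply _ (measurableSet_cube _ _), ENNReal.div_eq_inv_mul]

theorem lintegral_cube_ne_top {v : (Fin n → ℝ) → ℝ} (hv : IsWeight v) (a : Fin n → ℝ) (l : ℝ) :
    ∫⁻ x in cube a l, ENNReal.ofReal (v x) ≠ ∞ := by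
  have hint : IntegrableOn v (cube a l) :=
    hv.locallyIntegrable.integrableOn_isCompact (isCompact_cube _ _)
  exact hint.lintegral_lt_top.ne

theorem avg_ne_top {v : (Fin n → ℝ) → ℝ} (hv : IsWeight v) (a : Fin n → ℝ) {l : ℝ} (hl : 0 < l) :
    avg (cube a l) v ≠ ∞ :=
  ENNReal.mul_ne_top (ENNReal.inv_ne_top.2 (volume_cube_ne_zero a hl)) (lintegral_cube_ne_top hv a l)

theorem lintegral_cube_ne_zero {v : (Fin n → ℝ) → ℝ} (hv : IsWeight v) (a : Fin n → ℝ) {l : ℝ}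
    (hl : 0 < l) : ∫⁻ x in cube a l, ENNReal.ofReal (v x) ≠ 0 := by
  intro h
  rw [lintegral_eq_zero_iff' hv.locallyIntegrable.aestronglyMeasurable.aemeasurable.ennreal_ofReal.restrict]
    at h
  have h2 : ∀ᵐ x ∂(volume.restrict (cube a l)), False := by
    filter_upwards [h, ae_restrict_of_ae hv.pos] with x hx hx'
    simp only [Pi.zero_apply, ENNReal.ofReal_eq_zero] at hx
    linarith
  rw [Filter.eventually_false_iff_eq_bot, ae_eq_bot, Measure.restrict_eq_zero] at h2
  exact volume_cube_ne_zero a hl h2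

/-- Supplies an exponent so small that the growth `(A ^ s)⁻¹` per layer is beaten by the decay `δ`.
Taking `s = 1/m` with `δ ^ m < A` suffices. -/
theorem exists_exponent {A δ : ℝ≥0∞} (hA0 : A ≠ 0) (hδ : δ < 1) :
    ∃ s : ℝ, 0 < s ∧ δ < A ^ s := by
  have h := ENNReal.tendsto_pow_atTop_nhds_zero_of_lt_one hδ
  obtain ⟨m, hm, hm0⟩ := ((h.eventually (gt_mem_nhds (pos_iff_ne_zero.2 hA0))).and
    (Filter.eventually_gt_atTop 0)).exists
  refine ⟨(m : ℝ)⁻¹, by positivity, ?_⟩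
  have hm' : (0 : ℝ) < m := by exact_mod_cast hm0
  rw [ENNReal.lt_rpow_inv_iff hm', ENNReal.rpow_natCast]
  exact hm

/-- The pointwise bound of a negative power by a sum over the layers. -/
theorem inv_rpow_le_layers {f T A : ℝ≥0∞} {s : ℝ} (hs : 0 < s) (hf : f ≠ 0) (hT : T ≠ ∞)
    (hA : A < 1) (χ : ℕ → ℝ≥0∞) (hχ : ∀ k, f < A ^ k * T → 1 ≤ χ k) :
    (f ^ s)⁻¹ ≤ (T ^ s)⁻¹ * (1 + ∑' k, ((A ^ s)⁻¹) ^ (k + 1) * χ k) := by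
  classical
  rcases le_or_gt T f with h | h
  · calc (f ^ s)⁻¹ ≤ (T ^ s)⁻¹ := by gcongr
      _ = (T ^ s)⁻¹ * 1 := (mul_one _).symm
      _ ≤ _ := by gcongr; exact le_self_add
  have hlim : Filter.Tendsto (fun k : ℕ => A ^ (k + 1) * T) Filter.atTop (nhds (0 * T)) :=
    ENNReal.Tendsto.mul_const ((Filter.tendsto_add_atTop_iff_nat 1).2
      (ENNReal.tendsto_pow_atTop_nhds_zero_of_lt_one hA)) (Or.inr hT)
  rw [zero_mul] at hlim
  -- For the least such `k`, `f` lies in the layer between `A ^ (k + 1) * T` and `A ^ k * T`, and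
  -- the `k`-th term alone dominates.
  have hex : ∃ k : ℕ, A ^ (k + 1) * T ≤ f :=
    ((hlim.eventually (gt_mem_nhds (pos_iff_ne_zero.2 hf))).exists).imp fun _ h => h.le
  have hk := Nat.find_spec hex
  have hmin := fun m => Nat.find_min hex (m := m)
  set k := Nat.find hex
  have hlt : f < A ^ k * T := by
    rcases Nat.eq_zero_or_pos k with h0 | h0
    · rw [h0]; simpa using h
    · have := not_le.1 (hmin (k - 1) (by omega))
      rwa [Nat.sub_add_cancel h0] at this
  have hAT : ((A ^ (k + 1) * T) ^ s)⁻¹ = (T ^ s)⁻¹ * ((A ^ s)⁻¹) ^ (k + 1) := by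
    rw [ENNReal.mul_rpow_of_nonneg _ _ hs.le, ENNReal.mul_inv, mul_comm, ← ENNReal.inv_pow]
    · congr 2
      rw [← ENNReal.rpow_natCast, ← ENNReal.rpow_natCast, ← ENNReal.rpow_mul, ← ENNReal.rpow_mul,
        mul_comm]
    · exact Or.inr (ENNReal.rpow_ne_top_of_nonneg hs.le hT)
    · exact Or.inl (ENNReal.rpow_ne_top_of_nonneg hs.le (ENNReal.pow_ne_top (hA.trans_le le_top).ne))
  calc (f ^ s)⁻¹ ≤ ((A ^ (k + 1) * T) ^ s)⁻¹ := by gcongr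
    _ = (T ^ s)⁻¹ * (((A ^ s)⁻¹) ^ (k + 1) * 1) := by rw [hAT, mul_one]
    _ ≤ (T ^ s)⁻¹ * (((A ^ s)⁻¹) ^ (k + 1) * χ k) := by gcongr; exact hχ k hlt
    _ ≤ _ := by
        gcongr
        exact (ENNReal.le_tsum (f := fun k => ((A ^ s)⁻¹) ^ (k + 1) * χ k) k).trans le_add_self

/-- A weight for which sets of small relative mass are not almost full belongs to `A_∞`. -/
theorem memAInfty_of_small_sets {v : (Fin n → ℝ) → ℝ} (hv : IsWeight v) {β δ : ℝ≥0∞}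
    (hβ : β ≠ 0) (hβ1 : β < 1) (hδ1 : δ < 1)
    (hδ : ∀ (a : Fin n → ℝ) (l : ℝ), 0 < l → ∀ E, MeasurableSet E → E ⊆ cube a l →
      ∫⁻ x in E, ENNReal.ofReal (v x) ≤ β * ∫⁻ x in cube a l, ENNReal.ofReal (v x) →
        volume E ≤ δ * volume (cube a l)) :
    MemAInfty v := by
  set ν := (volume : Measure (Fin n → ℝ)).withDensity (fun x => ENNReal.ofReal (v x)) with hν
  obtain ⟨A, hA0, hA1, hdecay⟩ := exists_measure_lowDensity_decay ν
    (withDensity_absolutelyContinuous _ _) hβ hβ1 hδ1 (by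
      intro a l hl E hE hsub hle
      rw [withDensity_apply _ hE, withDensity_apply _ (measurableSet_cube _ _)] at hle
      exact hδ a l hl E hE hsub hle)
  obtain ⟨s, hs, hsA⟩ := exists_exponent hA0 hδ1
  have hAs0 : A ^ s ≠ 0 := (lt_of_le_of_lt (zero_le) hsA).ne'
  set B := (A ^ s)⁻¹ with hB
  have hBt : B ≠ ∞ := ENNReal.inv_ne_top.2 hAs0
  have hBδ : B * δ < 1 := by
    rw [hB, ← ENNReal.div_eq_inv_mul]
    exact ENNReal.div_lt_of_lt_mul (by rwa [one_mul])
  set C : ℝ≥0∞ := 1 + B * (1 - B * δ)⁻¹ with hC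
  have hCt : C ≠ ∞ := ENNReal.add_ne_top.2 ⟨ENNReal.one_ne_top,
    ENNReal.mul_ne_top hBt (ENNReal.inv_ne_top.2 (tsub_pos_of_lt hBδ).ne')⟩
  have hC0 : C ≠ 0 := by
    rw [hC]; exact (add_pos_of_pos_of_nonneg one_pos (zero_le)).ne'
  have hmain : ∀ (a : Fin n → ℝ) (l : ℝ), 0 < l →
      avg (cube a l) (fun x => v x ^ (-s)) ≤ C * (avg (cube a l) v ^ s)⁻¹ := by
    intro a l hl
    set T := avg (cube a l) v with hT
    have hG : ∀ k, MeasurableSet (lowDensity (dyadicIndex a l) volume ν a (A ^ k * T)) := fun k =>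
      measurableSet_lowDensity _ _ _ _
        (fun j k => measurable_dyadicIndex a l j (measurableSet_singleton k))
    have hroot : fiberCell (dyadicIndex a l) 0 a =ᵐ[volume] cube a l := by
      have h := fiberCell_ae_eq_cube a hl 0 a
      have hc : dyadicCorner a l 0 a = a := by
        ext i; simp [dyadicCorner, dyadicIndex]
      rwa [hc, pow_zero, div_one] at h
    have hrootm : MeasurableSet (fiberCell (dyadicIndex a l) 0 a) :=
      measurable_dyadicIndex a l 0 (measurableSet_singleton _)
    have hpt : ∀ᵐ x ∂(volume.restrict (cube a l)), ENNReal.ofReal (v x ^ (-s)) ≤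
        (T ^ s)⁻¹ * (1 + ∑' k, B ^ (k + 1) *
          (lowDensity (dyadicIndex a l) volume ν a (A ^ k * T)).indicator 1 x) := by
      -- Low density sets live in the half-open root cell, so the closed cube is replaced by it up
      -- to a null set.
      rw [← Measure.restrict_congr_set hroot]
      filter_upwards [ae_restrict_of_ae hv.pos, ae_restrict_mem hrootm,
        ae_restrict_of_ae (ae_exists_fiberCell_lt hv a hl)] with x hx0 hxm hx
      rw [← ENNReal.ofReal_rpow_of_pos hx0, ENNReal.rpow_neg]
      refine inv_rpow_le_layers hs (ENNReal.ofReal_pos.2 hx0).ne' (avg_ne_top hv a hl) hA1 _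
        fun k hk => ?_
      rw [Set.indicator_of_mem]
      · simp
      · exact ⟨hxm, hx _ hk⟩
    have hsum : ∑' k, B ^ (k + 1) * δ ^ k = B * (1 - B * δ)⁻¹ := by
      rw [← ENNReal.tsum_geometric, ← ENNReal.tsum_mul_left]
      refine tsum_congr fun k => ?_
      rw [mul_pow, pow_succ']
      ring
    have hint : ∫⁻ x in cube a l, ENNReal.ofReal (v x ^ (-s)) ≤
        (T ^ s)⁻¹ * (C * volume (cube a l)) := by
      refine (lintegral_mono_ae hpt).trans ?_
      have hm1 : ∀ k, Measurable fun x => B ^ (k + 1) *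
          (lowDensity (dyadicIndex a l) volume ν a (A ^ k * T)).indicator
            (1 : (Fin n → ℝ) → ℝ≥0∞) x := fun k =>
        (measurable_one.indicator (hG k)).const_mul _
      have hm2 : Measurable fun x => 1 + ∑' k, B ^ (k + 1) *
          (lowDensity (dyadicIndex a l) volume ν a (A ^ k * T)).indicator
            (1 : (Fin n → ℝ) → ℝ≥0∞) x := measurable_const.add (Measurable.tsum hm1)
      rw [lintegral_const_mul _ hm2, lintegral_add_left measurable_const, lintegral_tsum fun k => (hm1 k).aemeasurable]
      gcongr
      rw [hC, add_mul, ← hsum, ← ENNReal.tsum_mul_right]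
      refine add_le_add (by simp) (ENNReal.tsum_le_tsum fun k => ?_)
      rw [lintegral_const_mul _ (measurable_one.indicator (hG k)), lintegral_indicator_one (hG k),
        mul_assoc]
      gcongr
      refine (Measure.restrict_apply_le _ _).trans ?_
      have := hdecay a l hl k
      rwa [withDensity_cube, ← hT] at this
    calc avg (cube a l) (fun x => v x ^ (-s))
        ≤ (volume (cube a l))⁻¹ * ((T ^ s)⁻¹ * (C * volume (cube a l))) := by
          rw [avg]; gcongr
      _ = C * (T ^ s)⁻¹ * ((volume (cube a l))⁻¹ * volume (cube a l)) := by ring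
      _ ≤ C * (T ^ s)⁻¹ * 1 := by gcongr; exact ENNReal.inv_mul_le_one _
      _ = _ := mul_one _
  have hCs : C ^ s⁻¹ ≠ ∞ := ENNReal.rpow_ne_top_of_nonneg (by positivity) hCt
  -- The choice `q = 1 + s⁻¹` turns the dual exponent `-1 / (q - 1)` into `-s`.
  refine Or.inr ⟨1 + s⁻¹, by simpa using hs, hv, (C ^ s⁻¹).toNNReal, ?_, fun a l hl => ?_⟩
  · exact ENNReal.toNNReal_pos (ENNReal.rpow_pos (pos_iff_ne_zero.2 hC0) hCt).ne' hCs
  rw [ENNReal.coe_toNNReal hCs, add_sub_cancel_left]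
  have he : (-1 / s⁻¹ : ℝ) = -s := by rw [div_inv_eq_mul]; ring
  rw [he]
  have hsi : 0 ≤ s⁻¹ := by positivity
  calc avg (cube a l) v * avg (cube a l) (fun x => v x ^ (-s)) ^ s⁻¹
      ≤ avg (cube a l) v * (C * (avg (cube a l) v ^ s)⁻¹) ^ s⁻¹ := by
        gcongr; exact hmain a l hl
    _ = C ^ s⁻¹ * (avg (cube a l) v * (avg (cube a l) v)⁻¹) := by
        rw [ENNReal.mul_rpow_of_nonneg _ _ hsi, ENNReal.inv_rpow, ← ENNReal.rpow_mul,
          mul_inv_cancel₀ hs.ne', ENNReal.rpow_one]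
        ring
    _ ≤ C ^ s⁻¹ * 1 := by gcongr; exact ENNReal.mul_inv_le_one _
    _ = C ^ s⁻¹ := mul_one _

/-! ### From A_q to the reverse Hölder inequality -/

/-- The A_1 condition bounds `1 / v` almost everywhere on the cube by `C` over the mean of `v`;
averaging this gives the claim. -/
theorem MemAOne.memA_two {v : (Fin n → ℝ) → ℝ} (h : MemAOne v) : MemA 2 v := by
  obtain ⟨hv, C, hC, hA⟩ := h
  refine ⟨hv, C, hC, fun a l hl => ?_⟩
  have h1 : ((2 : ℝ) - 1) = 1 := by norm_num
  rw [h1, ENNReal.rpow_one, div_one]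
  set T := avg (cube a l) v with hT
  have hC0 : (C : ℝ≥0∞) ≠ 0 := by exact_mod_cast hC.ne'
  have hpt : ∀ᵐ x ∂(volume.restrict (cube a l)), ENNReal.ofReal (v x ^ (-1 : ℝ)) ≤ C * T⁻¹ := by
    filter_upwards [hA a l hl, ae_restrict_of_ae hv.pos] with x hx hx0
    rw [Real.rpow_neg_one, ENNReal.ofReal_inv_of_pos hx0]
    calc (ENNReal.ofReal (v x))⁻¹ ≤ ((C : ℝ≥0∞)⁻¹ * T)⁻¹ := by
          gcongr
          rw [← ENNReal.div_eq_inv_mul]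
          exact ENNReal.div_le_of_le_mul' hx
      _ = C * T⁻¹ := by
          rw [ENNReal.mul_inv (Or.inl (ENNReal.inv_ne_zero.2 ENNReal.coe_ne_top))
            (Or.inl (ENNReal.inv_ne_top.2 hC0)), inv_inv]
  calc T * avg (cube a l) (fun x => v x ^ (-1 : ℝ))
      ≤ T * ((volume (cube a l))⁻¹ * ∫⁻ _ in cube a l, C * T⁻¹) := by
        rw [avg]
        gcongr T * (_ * ?_)
        exact lintegral_mono_ae hpt
    _ = C * (T * T⁻¹) * ((volume (cube a l))⁻¹ * volume (cube a l)) := by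
        rw [lintegral_const, Measure.restrict_apply_univ]; ring
    _ ≤ C * 1 * 1 := by
        gcongr
        · exact ENNReal.mul_inv_le_one _
        · exact ENNReal.inv_mul_le_one _
    _ = C := by simp

/-- A consequence of Hölder's inequality: a power mean of negative order is at most the
arithmetic mean. -/
theorem one_le_lintegral_mul_lintegral_inv_rpow {X : Type*} [MeasurableSpace X] (m : Measure X)
    [IsProbabilityMeasure m] {f : X → ℝ≥0∞} (hf : AEMeasurable f m) (hf0 : ∀ᵐ x ∂m, f x ≠ 0)
    (hft : ∀ᵐ x ∂m, f x ≠ ∞) {S : ℝ} (hS : 0 < S) :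
    1 ≤ (∫⁻ x, f x ∂m) * (∫⁻ x, f x ^ (-S) ∂m) ^ (1 / S) := by
  -- Hölder is applied to `1 = f ^ (S / (1 + S)) * f ^ (-(S / (1 + S)))`, with exponents that turn
  -- the factors into `f` and `f ^ (-S)`.
  have hconj : ((1 + S) / S).HolderConjugate (1 + S) := by
    rw [Real.holderConjugate_iff]
    constructor
    · rw [lt_div_iff₀ hS]; linarith
    · have : 1 + S ≠ 0 := by positivity
      field_simp
      ring
  have hα : S / (1 + S) * ((1 + S) / S) = 1 := by field_simp
  have hol := ENNReal.lintegral_mul_le_Lp_mul_Lq m hconj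
    (hf.pow_const (S / (1 + S))) (hf.pow_const (-(S / (1 + S))))
  have e1 : ∫⁻ x, ((fun x => f x ^ (S / (1 + S))) * fun x => f x ^ (-(S / (1 + S)))) x ∂m = 1 := by
    have h1 : ∫⁻ _, (1 : ℝ≥0∞) ∂m = 1 := by simp
    rw [← h1]
    refine lintegral_congr_ae ?_
    filter_upwards [hf0, hft] with x h0 ht
    simp only [Pi.mul_apply]
    rw [← ENNReal.rpow_add _ _ h0 ht, add_neg_cancel, ENNReal.rpow_zero]
  have e2 : ∀ x, (f x ^ (S / (1 + S))) ^ ((1 + S) / S) = f x := fun x => by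
    rw [← ENNReal.rpow_mul, hα, ENNReal.rpow_one]
  have e3 : ∀ x, (f x ^ (-(S / (1 + S)))) ^ (1 + S) = f x ^ (-S) := fun x => by
    rw [← ENNReal.rpow_mul]
    congr 1
    field_simp
  rw [e1] at hol
  simp only [e2, e3] at hol
  have h3 := ENNReal.rpow_le_rpow hol (z := (1 + S) / S) (by positivity)
  rw [ENNReal.one_rpow, ENNReal.mul_rpow_of_nonneg _ _ (by positivity), ← ENNReal.rpow_mul,
    ← ENNReal.rpow_mul] at h3
  have e4 : 1 / ((1 + S) / S) * ((1 + S) / S) = 1 := by field_simp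
  have e5 : 1 / (1 + S) * ((1 + S) / S) = 1 / S := by field_simp
  rwa [e4, e5, ENNReal.rpow_one] at h3

/-- With `S = p / (q - 1)`, the dual factor of A_q for `w ^ p` is the mean of `w ^ (-S)` raised to
`q - 1`. It is at least the mean of `w` to the power `-p`, so it can be traded for that power. -/
theorem memRH_of_memA {w : (Fin n → ℝ) → ℝ} (hw : IsWeight w) {p q : ℝ} (hp : 0 < p)
    (hq : 1 < q) (h : MemA q (fun x => w x ^ p)) : MemRH p w := by
  obtain ⟨hv, C, hC, hA⟩ := h
  refine ⟨hw, C ^ (1 / p), NNReal.rpow_pos hC, fun a l hl => ?_⟩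
  have hq0 : 0 < q - 1 := by linarith
  have hQ0 := volume_cube_ne_zero a hl
  have hQt := volume_cube_ne_top a l
  set m := (volume (cube a l))⁻¹ • (volume : Measure (Fin n → ℝ)).restrict (cube a l) with hm
  have hmac : m ≪ volume :=
    (Measure.smul_absolutelyContinuous).trans Measure.restrict_le_self.absolutelyContinuous
  have hprob : IsProbabilityMeasure m := by
    refine ⟨?_⟩
    rw [hm, Measure.smul_apply, Measure.restrict_apply_univ, smul_eq_mul,
      ENNReal.inv_mul_cancel hQ0 hQt]
  have havg : ∀ g, avg (cube a l) g = ∫⁻ x, ENNReal.ofReal (g x) ∂m := fun g => by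
    rw [avg, hm, lintegral_smul_measure, smul_eq_mul]
  set S : ℝ := p / (q - 1) with hS
  have hSpos : 0 < S := by positivity
  have hwm : AEMeasurable (fun x => ENNReal.ofReal (w x)) m :=
    (hw.locallyIntegrable.aestronglyMeasurable.aemeasurable.ennreal_ofReal).mono_ac hmac
  have hwpos : ∀ᵐ x ∂m, 0 < w x := hmac.ae_le hw.pos
  have hol := one_le_lintegral_mul_lintegral_inv_rpow m hwm
    (hwpos.mono fun x hx => (ENNReal.ofReal_pos.2 hx).ne')
    (Filter.Eventually.of_forall fun x => ENNReal.ofReal_ne_top) hSpos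
  have hA' := hA a l hl
  have e1 : avg (cube a l) (fun x => (w x ^ p) ^ (-1 / (q - 1))) =
      ∫⁻ x, ENNReal.ofReal (w x) ^ (-S) ∂m := by
    rw [havg]
    refine lintegral_congr_ae (hwpos.mono fun x hx => ?_)
    simp only
    rw [ENNReal.ofReal_rpow_of_pos hx, ← Real.rpow_mul hx.le]
    congr 2
    rw [hS]; ring
  rw [e1] at hA'
  rw [← havg] at hol
  set I := ∫⁻ x, ENNReal.ofReal (w x) ^ (-S) ∂m
  have h1 : 1 ≤ avg (cube a l) w ^ p * I ^ (q - 1) := by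
    have := ENNReal.rpow_le_rpow hol hp.le
    rw [ENNReal.one_rpow, ENNReal.mul_rpow_of_nonneg _ _ hp.le, ← ENNReal.rpow_mul] at this
    convert this using 3
    rw [hS]; field_simp
  have h2 : avg (cube a l) (fun x => w x ^ p) ≤ C * avg (cube a l) w ^ p := by
    calc avg (cube a l) (fun x => w x ^ p) = avg (cube a l) (fun x => w x ^ p) * 1 :=
          (mul_one _).symm
      _ ≤ avg (cube a l) (fun x => w x ^ p) * (avg (cube a l) w ^ p * I ^ (q - 1)) := by gcongr
      _ = avg (cube a l) (fun x => w x ^ p) * I ^ (q - 1) * avg (cube a l) w ^ p := by ring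
      _ ≤ C * avg (cube a l) w ^ p := by gcongr
  have hp' : 0 ≤ 1 / p := by positivity
  calc _ ≤ (C * avg (cube a l) w ^ p) ^ (1 / p) := by gcongr
    _ = _ := by
      rw [ENNReal.mul_rpow_of_nonneg _ _ hp', ← ENNReal.rpow_mul, mul_one_div_cancel hp.ne',
        ENNReal.rpow_one, ENNReal.coe_rpow_of_nonneg _ hp']

/-! ### From the reverse Hölder inequality to A_∞ -/

/-- Averages take values in `[0, ∞]`, so the reverse Hölder bound by a finite mean of `w` itself
forces `w ^ p` to be integrable on cubes. -/
theorem MemRH.isWeight_rpow {w : (Fin n → ℝ) → ℝ} {p : ℝ} (hp : 0 < p) (h : MemRH p w) :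
    IsWeight fun x => w x ^ p := by
  obtain ⟨hw, C, hC, hRH⟩ := h
  have hwm := hw.locallyIntegrable.aestronglyMeasurable.aemeasurable
  refine ⟨fun x => ?_, hw.pos.mono fun x hx => Real.rpow_pos_of_pos hx p⟩
  have hmem : cube (fun i => x i - 1) 2 ∈ nhds x := by
    rw [cube_eq_closedBall _ (by norm_num)]
    have : (fun i => x i - 1 + 2 / 2) = x := by ext i; ring
    rw [this]
    exact Metric.closedBall_mem_nhds _ (by norm_num)
  refine ⟨_, hmem, (hwm.pow_const p).aestronglyMeasurable.restrict, ?_⟩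
  rw [hasFiniteIntegral_iff_ofReal (ae_restrict_of_ae
    (hw.pos.mono fun x hx => (Real.rpow_pos_of_pos hx p).le))]
  have h1 := (hRH (fun i => x i - 1) 2 two_pos).trans_lt
    (ENNReal.mul_lt_top ENNReal.coe_lt_top (avg_ne_top hw _ two_pos).lt_top)
  have h2 : avg (cube (fun i => x i - 1) 2) (fun x => w x ^ p) < ∞ := by
    by_contra! hcon
    rw [top_le_iff] at hcon
    rw [hcon, ENNReal.top_rpow_of_pos (by positivity)] at h1
    exact lt_irrefl _ h1
  rw [avg] at h2
  by_contra! hcon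
  rw [top_le_iff] at hcon
  rw [hcon, ENNReal.mul_top (ENNReal.inv_ne_zero.2 (volume_cube_ne_top _ _))] at h2
  exact lt_irrefl _ h2

theorem lintegral_le_rpow_mul_measure_rpow {w : (Fin n → ℝ) → ℝ} (hw : IsWeight w) {p r : ℝ}
    (hpr : p.HolderConjugate r) (E : Set (Fin n → ℝ)) :
    ∫⁻ x in E, ENNReal.ofReal (w x) ≤
      (∫⁻ x in E, ENNReal.ofReal (w x ^ p)) ^ (1 / p) * volume E ^ (1 / r) := by
  have hwm := hw.locallyIntegrable.aestronglyMeasurable.aemeasurable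
  have h := ENNReal.lintegral_mul_le_Lp_mul_Lq ((volume : Measure (Fin n → ℝ)).restrict E) hpr
    hwm.ennreal_ofReal.restrict (aemeasurable_const (b := (1 : ℝ≥0∞)))
  simp only [Pi.mul_apply, mul_one, ENNReal.one_rpow, lintegral_one,
    Measure.restrict_apply_univ] at h
  convert h using 3
  refine lintegral_congr_ae (ae_restrict_of_ae (hw.pos.mono fun x hx => ?_))
  simp only
  rw [ENNReal.ofReal_rpow_of_pos hx]

theorem memAInfty_of_memRH {w : (Fin n → ℝ) → ℝ} {p : ℝ} (hp : 1 < p) (h : MemRH p w) :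
    MemAInfty fun x => w x ^ p := by
  have hv := h.isWeight_rpow (by linarith)
  obtain ⟨hw, C₀, hC₀, hRH⟩ := h
  have hp0 : 0 < p := by linarith
  obtain ⟨r, hpr⟩ : ∃ r, p.HolderConjugate r := ⟨_, Real.HolderConjugate.conjExponent hp⟩
  have hr0 : 0 < r := hpr.symm.pos
  -- Adding 1 ensures `2 * C > 1`, hence `η < 1`; the choice `η = 1 / (2C)` lets the contribution of
  -- `E` be absorbed with half to spare.
  set C : ℝ≥0 := C₀ + 1 with hC
  set η : ℝ≥0 := (2 * C)⁻¹ with hη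
  have hη0 : 0 < η := by positivity
  have hη1 : η < 1 := by
    rw [hη]
    exact inv_lt_one_of_one_lt₀ (by linarith)
  have hηC : (η : ℝ) * (2 * C) = 1 := by
    have : (C : ℝ) ≠ 0 := by positivity
    rw [hη]; push_cast; field_simp
  refine memAInfty_of_small_sets hv (β := ((η ^ p : ℝ≥0) : ℝ≥0∞))
    (δ := 1 - ((η ^ r : ℝ≥0) : ℝ≥0∞)) ?_ ?_ ?_ fun a l hl E hE hsub hle => ?_
  · exact_mod_cast (NNReal.rpow_pos hη0).ne'
  · exact_mod_cast NNReal.rpow_lt_one hη1 hp0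
  · refine ENNReal.sub_lt_self ENNReal.one_ne_top one_ne_zero ?_
    exact_mod_cast (NNReal.rpow_pos hη0).ne'
  have hQ0 := volume_cube_ne_zero a hl
  have hQt := volume_cube_ne_top a l
  have hQm := measurableSet_cube a l
  have hVt := lintegral_cube_ne_top hv a l
  have hV0 := lintegral_cube_ne_zero hv a hl
  set Q := cube a l with hQ
  set V := ∫⁻ x in Q, ENNReal.ofReal (w x ^ p) with hV
  set N := V ^ (1 / p) with hN
  set M := volume Q ^ (1 / r) with hM
  set R := volume (Q \ E) ^ (1 / r) with hR
  have hp' : 0 ≤ 1 / p := by positivity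
  have hr' : 0 ≤ 1 / r := by positivity
  have hDt : volume (Q \ E) ≠ ∞ := ne_top_of_le_ne_top hQt (measure_mono Set.sdiff_subset)
  have hNt : N ≠ ∞ := ENNReal.rpow_ne_top_of_nonneg hp' hVt
  have hMt : M ≠ ∞ := ENNReal.rpow_ne_top_of_nonneg hr' hQt
  have hRt : R ≠ ∞ := ENNReal.rpow_ne_top_of_nonneg hr' hDt
  have hN0 : N ≠ 0 := (ENNReal.rpow_pos (pos_iff_ne_zero.2 hV0) hVt).ne'
  have h1 : N * M ≤ C * ∫⁻ x in Q, ENNReal.ofReal (w x) := by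
    have hrh : (avg Q fun x => w x ^ p) ^ (1 / p) ≤ C * avg Q w := by
      refine (hRH a l hl).trans ?_
      gcongr
      rw [hC]; exact le_self_add
    rw [avg, avg, ENNReal.mul_rpow_of_nonneg _ _ hp'] at hrh
    have hM' : M = volume Q * (volume Q)⁻¹ ^ (1 / p) := by
      rw [hM, ENNReal.inv_rpow, ← ENNReal.rpow_neg]
      nth_rewrite 2 [← ENNReal.rpow_one (volume Q)]
      rw [← ENNReal.rpow_add _ _ hQ0 hQt]
      congr 1
      have := hpr.inv_add_inv_eq_one
      rw [one_div, one_div]; linarith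
    calc N * M = volume Q * ((volume Q)⁻¹ ^ (1 / p) * N) := by rw [hM']; ring
      _ ≤ volume Q * (C * ((volume Q)⁻¹ * ∫⁻ x in Q, ENNReal.ofReal (w x))) := by gcongr
      _ = (volume Q * (volume Q)⁻¹) * (C * ∫⁻ x in Q, ENNReal.ofReal (w x)) := by ring
      _ = _ := by rw [ENNReal.mul_inv_cancel hQ0 hQt, one_mul]
  have h2 : ∫⁻ x in Q, ENNReal.ofReal (w x) ≤ η * N * M + N * R := by
    rw [← lintegral_inter_add_sdiff _ Q hE, Set.inter_eq_right.2 hsub]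
    refine add_le_add ((lintegral_le_rpow_mul_measure_rpow hw hpr E).trans ?_)
      ((lintegral_le_rpow_mul_measure_rpow hw hpr (Q \ E)).trans ?_)
    · gcongr
      · calc (∫⁻ x in E, ENNReal.ofReal (w x ^ p)) ^ (1 / p)
            ≤ (((η ^ p : ℝ≥0) : ℝ≥0∞) * V) ^ (1 / p) := by gcongr
          _ = η * N := by
            rw [ENNReal.mul_rpow_of_nonneg _ _ hp', ENNReal.coe_rpow_of_nonneg _ hp0.le,
              ← ENNReal.rpow_mul, mul_one_div_cancel hp0.ne', ENNReal.rpow_one]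
      · exact ENNReal.rpow_le_rpow (measure_mono hsub) hr'
    · gcongr
      exact ENNReal.rpow_le_rpow (lintegral_mono_set Set.sdiff_subset) hp'
  -- Dividing `h1` and `h2` by `N` gives `M ≤ C η M + C R = M / 2 + C R`.
  have h3 : (η : ℝ≥0∞) * M ≤ R := by
    have h4 : N * M ≤ C * (η * N * M + N * R) := h1.trans (by gcongr)
    have hNr : 0 < N.toReal := ENNReal.toReal_pos hN0 hNt
    clear_value N M R
    clear h1 h2 hN hM hR
    lift N to ℝ≥0 using hNt
    lift M to ℝ≥0 using hMt
    lift R to ℝ≥0 using hRt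
    norm_cast at h4 ⊢
    rw [← NNReal.coe_le_coe] at h4 ⊢
    push_cast at h4 ⊢
    simp only [ENNReal.coe_toReal] at hNr
    have h5 : (M : ℝ) ≤ C * (η * M + R) := by
      refine le_of_mul_le_mul_left ?_ hNr
      linarith
    have hη' : (0 : ℝ) < η := by exact_mod_cast hη0
    nlinarith [mul_le_mul_of_nonneg_left h5 hη'.le]
  have h6 : ((η ^ r : ℝ≥0) : ℝ≥0∞) * volume Q ≤ volume (Q \ E) := by
    have := ENNReal.rpow_le_rpow h3 hr0.le
    rwa [ENNReal.mul_rpow_of_nonneg _ _ hr0.le, hM, hR, ← ENNReal.rpow_mul, ← ENNReal.rpow_mul,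
      one_div_mul_cancel hr0.ne', ENNReal.rpow_one, ENNReal.rpow_one,
      ← ENNReal.coe_rpow_of_nonneg _ hr0.le] at this
  have hEQ : volume E = volume Q - volume (Q \ E) := by
    rw [← measure_sdiff Set.sdiff_subset (hQm.diff hE).nullMeasurableSet hDt,
      Set.sdiff_sdiff_cancel_left hsub]
  rw [hEQ, ENNReal.sub_mul fun _ _ => hQt, one_mul]
  gcongr

end Weights

end ReverseHolder


theorem mainTheorem9 (n : ℕ) (p : ℝ) (hp : 1 < p) (w : (Fin n → ℝ) → ℝ)
    (hw : ReverseHolder.IsWeight w) :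
    ReverseHolder.MemRH p w ↔ ReverseHolder.MemAInfty (fun x => w x ^ p) := by
  refine ⟨ReverseHolder.memAInfty_of_memRH hp, ?_⟩
  rintro (h | ⟨q, hq, h⟩)
  · exact ReverseHolder.memRH_of_memA hw (by linarith) one_lt_two h.memA_two
  · exact ReverseHolder.memRH_of_memA hw (by linarith) hq h
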